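/- Let $k$ be a field of characteristic $0$ (for instance $k=\mathbb{C}$) and let $K$ be the field of Puiseux series over $k$, i.e. of formal series $a=\sum_{q\in\mathbb{Q}}a_qt^q$ with $a_q\in k$ whose set of exponents $\{q : a_q\neq 0\}$ is bounded below and has a common denominator; for $a\ne 0$ let $\mathrm{val}(a)$ be the least exponent of $a$. For an ideal $I\subseteq K[x_1,\dots,x_N]$ consider the two usual descriptions of its tropical variety (for algebraically closed $k$ they define the same set $\mathcal{T}(I)\subseteq\mathbb{R}^N$): 1. $\mathcal{T}_1(I)$ is the set of all $x\in\mathbb{R}^N$ such that for every nonzero $f=\sum_a g_a x^a\in I$ the maximum of the numbers $-\mathrm{val}(g_a)+\sum_i a_ix_i$ over all $a$ with $g_a\neq 0$ is attained at least twice; 2. $\mathcal{T}_2(I)$ is the closure in $\mathbb{R}^N$ of the set of all points $(-\mathrm{val}(y_1),\dots,-\mathrm{val}(y_N))$ where $y\in K^N$ is a zero of $I$ with all $y_i\neq 0$. For natural numbers $m,n$ let $I_{m,n}$ be the Plücker ideal, i.e. the ideal of all polynomials over $\mathbb{Z}$ in variables $x_{i_1\dots i_m}$ ($1\le i_1<\dots<i_m\le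 n$) that vanish on the $m\times m$ minors of the generic $m\times n$ matrix over $\mathbb{Z}$, and let the tropical Grassmannian $\mathcal{G}_{m,n}\subseteq\mathbb{R}^{\binom nm}$ be the tropical variety of the ideal generated by $I_{m,n}$ over $K$. For $m\ge 2$ let $\phi^{(m)}:\mathbb{R}^{\binom n2}\to\mathbb{R}^{\binom nm}$ be the map $(X_{i,j})\mapsto (X_{i_1,\dots,i_m})$ with $$X_{i_1,\dots,i_m}=\frac12\min_{\sigma}\sum_{r=0}^{m-1}X_{i_{\sigma^{r}(1)},\,i_{\sigma^{r+1}(1)}},$$ where $\sigma$ runs over the $m$-cycles in the symmetric group $S_m$ and $X_{j,i}=X_{i,j}$; so $\phi^{(3)}$ sends $X$ to the point with coordinates $\frac12(X_{i,j}+X_{i,k}+X_{j,k})$, $i<j<k$. Then, for every $n\in\mathbb{N}$, $$\phi^{(3)}(\mathcal{G}_{2,n})\subseteq\mathcal{G}_{3,n},$$ both when $\mathcal{G}_{2,n}$ and $\mathcal{G}_{3,n}$ are defined through $\mathcal{T}_1$ and when they are defined through $\mathcal{T}_2$. -/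

import Mathlib

open scoped BigOperators

noncomputable section

namespace TropicalDissimilarity

/-! ### The field of Puiseux series -/

section Puiseux

variable (k : Type*) [Field k]

/-- The ring homomorphism `t ↦ t ^ (1 / N)` from formal Laurent series over `k` to Hahn series
with exponents in `ℚ`. -/
def ramify (N : ℕ) (hN : 0 < N) : HahnSeries ℤ k →+* HahnSeries ℚ k :=
  have hN' : (0 : ℚ) < N := Nat.cast_pos.mpr hN
  HahnSeries.embDomainRingHom
    { toFun := fun z : ℤ => (z : ℚ) / N
      map_zero' := by simp
      map_add' := fun a b => by push_cast; ring }
    (fun a b h => by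
      have h' : (a : ℚ) / N = (b : ℚ) / N := h
      rw [div_left_inj' hN'.ne'] at h'
      exact_mod_cast h')
    (fun a b => by
      change (a : ℚ) / N ≤ (b : ℚ) / N ↔ a ≤ b
      rw [div_le_div_iff_of_pos_right hN']
      exact_mod_cast Iff.rfl)

variable {k} in
theorem mem_fieldRange_ramify (N : ℕ) (hN : 0 < N) (a : HahnSeries ℚ k) :
    a ∈ (ramify k N hN).fieldRange ↔ ∀ q ∈ a.support, ∃ z : ℤ, q = (z : ℚ) / N := by
  have hN' : (0 : ℚ) < N := Nat.cast_pos.mpr hN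
  constructor
  · rintro ⟨b, rfl⟩ q hq
    obtain ⟨z, -, hz⟩ := HahnSeries.support_embDomain_subset hq
    exact ⟨z, hz.symm⟩
  · intro h
    have hpwo : (Function.support fun z : ℤ => a.coeff ((z : ℚ) / N)).IsPWO := by
      rw [Set.isPWO_iff_isWF]
      have hwf := a.isWF_support
      rw [Set.isWF_iff_no_descending_seq] at hwf ⊢
      intro f hf hmem
      refine hwf (fun i => (f i : ℚ) / N) (fun i j hij => ?_) (fun i => ?_)
      · have : f j < f i := hf hij
        have h2 : (f j : ℚ) < f i := by exact_mod_cast this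
        exact div_lt_div_of_pos_right h2 hN'
      · exact hmem i
    refine ⟨⟨fun z : ℤ => a.coeff ((z : ℚ) / N), hpwo⟩, ?_⟩
    ext q
    by_cases hq : ∃ z : ℤ, q = (z : ℚ) / N
    · obtain ⟨z, rfl⟩ := hq
      exact HahnSeries.embDomain_coeff
        (x := (⟨fun z : ℤ => a.coeff ((z : ℚ) / N), hpwo⟩ : HahnSeries ℤ k)) (a := z)
    · have h0 : a.coeff q = 0 := by
        by_contra hne
        exact hq (h q hne)
      rw [h0]
      refine HahnSeries.embDomain_of_notMem_range ?_
      rintro ⟨z, rfl⟩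
      exact hq ⟨z, rfl⟩

variable {k} in
theorem mem_fieldRange_ramify_mul {N : ℕ} (hN : 0 < N) {M : ℕ} (hM : 0 < M)
    {a : HahnSeries ℚ k} (ha : ∀ q ∈ a.support, ∃ z : ℤ, q = (z : ℚ) / N) :
    a ∈ (ramify k (N * M) (Nat.mul_pos hN hM)).fieldRange := by
  rw [mem_fieldRange_ramify]
  intro q hq
  obtain ⟨z, rfl⟩ := ha q hq
  have hM' : (M : ℚ) ≠ 0 := by exact_mod_cast hM.ne'
  exact ⟨z * M, by push_cast; rw [mul_div_mul_right _ _ hM']⟩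

/-- The field of Puiseux series `∑ a_q t ^ q` over `k`: the Hahn series with exponents in `ℚ`
whose exponents have a common denominator.  (For such a family of coefficients, well-ordered
support is the same as support bounded below, see `isPWO_of_bddBelow`.) -/
def puiseuxSubfield : Subfield (HahnSeries ℚ k) where
  carrier := {a | ∃ N : ℕ, 0 < N ∧ ∀ q ∈ a.support, ∃ z : ℤ, q = (z : ℚ) / N}
  mul_mem' := by
    rintro a b ⟨N, hN, ha⟩ ⟨M, hM, hb⟩
    have ha' := mem_fieldRange_ramify_mul hN hM ha
    have hb' := mem_fieldRange_ramify_mul hM hN hb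
    simp only [Nat.mul_comm M N] at hb'
    exact ⟨N * M, Nat.mul_pos hN hM, (mem_fieldRange_ramify _ _ _).1 (mul_mem ha' hb')⟩
  add_mem' := by
    rintro a b ⟨N, hN, ha⟩ ⟨M, hM, hb⟩
    have ha' := mem_fieldRange_ramify_mul hN hM ha
    have hb' := mem_fieldRange_ramify_mul hM hN hb
    simp only [Nat.mul_comm M N] at hb'
    exact ⟨N * M, Nat.mul_pos hN hM, (mem_fieldRange_ramify _ _ _).1 (add_mem ha' hb')⟩
  one_mem' := ⟨1, one_pos, (mem_fieldRange_ramify _ one_pos _).1 (one_mem _)⟩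
  zero_mem' := ⟨1, one_pos, (mem_fieldRange_ramify _ one_pos _).1 (zero_mem _)⟩
  neg_mem' := by
    rintro a ⟨N, hN, ha⟩
    exact ⟨N, hN, (mem_fieldRange_ramify _ hN _).1
      (neg_mem ((mem_fieldRange_ramify _ hN _).2 ha))⟩
  inv_mem' := by
    rintro a ⟨N, hN, ha⟩
    exact ⟨N, hN, (mem_fieldRange_ramify _ hN _).1
      (inv_mem ((mem_fieldRange_ramify _ hN _).2 ha))⟩

/-- A set of rational numbers with a common denominator that is bounded below is partially
well-ordered. -/
theorem isPWO_of_bddBelow {s : Set ℚ} (hs : BddBelow s) {N : ℕ} (hN : 0 < N)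
    (h : ∀ q ∈ s, ∃ z : ℤ, q = (z : ℚ) / N) : s.IsPWO := by
  have hN' : (0 : ℚ) < N := Nat.cast_pos.mpr hN
  obtain ⟨b, hb⟩ := hs
  have hpre : {z : ℤ | (z : ℚ) / N ∈ s}.IsPWO := by
    refine (BddBelow.isWF ⟨⌊b * N⌋, fun z hz => ?_⟩).isPWO
    have h1 : b ≤ (z : ℚ) / N := hb hz
    rw [le_div_iff₀ hN'] at h1
    exact_mod_cast (Int.floor_le (b * N)).trans h1
  refine (hpre.image_of_monotone (f := fun z : ℤ => (z : ℚ) / N) fun x y hxy => ?_).mono ?_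
  · have : (x : ℚ) ≤ y := by exact_mod_cast hxy
    exact div_le_div_of_nonneg_right this hN'.le
  · intro q hq
    obtain ⟨z, rfl⟩ := h q hq
    exact ⟨z, hq, rfl⟩

/-- The field of Puiseux series over `k`. -/
abbrev Puiseux : Type _ := puiseuxSubfield k

variable {k} in
/-- The valuation of a nonzero Puiseux series, i.e. its least exponent (used below for nonzero
series only). -/
def val (a : Puiseux k) : ℝ := ((a : HahnSeries ℚ k).order : ℚ)

end Puiseux

/-! ### Tropical varieties -/

section Tropical

variable {k : Type*} [Field k] {ι : Type*} [Fintype ι]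

/-- The exponent of the tropical monomial of `trop f` at `a`, as a function of `x`:
`λ_a + ∑ i, a_i x_i` with `λ_a = -val (g_a)`, where `g_a` is the coefficient of `f` at `a`. -/
def tropTerm (f : MvPolynomial ι (Puiseux k)) (a : ι →₀ ℕ) (x : ι → ℝ) : ℝ :=
  -val (f.coeff a) + ∑ i, (a i : ℝ) * x i

/-- The tropical hypersurface of a nonzero polynomial `f`: the points at which the maximum over
the monomials of `trop f` is attained at least twice. -/
def tropicalHypersurface (f : MvPolynomial ι (Puiseux k)) : Set (ι → ℝ) :=
  {x | ∃ a ∈ f.support, ∃ b ∈ f.support, a ≠ b ∧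
    (∀ c ∈ f.support, tropTerm f c x ≤ tropTerm f a x) ∧
    (∀ c ∈ f.support, tropTerm f c x ≤ tropTerm f b x)}

/-- The tropical variety of an ideal as the intersection of all tropical hypersurfaces of its
nonzero members. -/
def tropicalVariety (I : Ideal (MvPolynomial ι (Puiseux k))) : Set (ι → ℝ) :=
  {x | ∀ f ∈ I, f ≠ 0 → x ∈ tropicalHypersurface f}

/-- The tropical variety of an ideal as the closure of the set of the negatives of the
valuations of the zeros of the ideal with nonzero coordinates. -/
def tropicalVarietyClosure (I : Ideal (MvPolynomial ι (Puiseux k))) : Set (ι → ℝ) :=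
  closure {x | ∃ y ∈ MvPolynomial.zeroLocus (Puiseux k) I,
    (∀ i, y i ≠ 0) ∧ x = fun i => -val (y i)}

end Tropical

/-! ### The tropical Grassmannian -/

/-- The index set of the coordinates of `ℝ ^ (n choose m)`: the strictly increasing sequences
`i₁ < ⋯ < i_m` in `Fin n`. -/
abbrev Idx (m n : ℕ) : Type := Fin m ↪o Fin n

/-- The `m × m` minor with columns `s` of the generic `m × n` matrix over `ℤ`. -/
def genericMinor (m n : ℕ) (s : Idx m n) : MvPolynomial (Fin m × Fin n) ℤ :=
  ((Matrix.mvPolynomialX (Fin m) (Fin n) ℤ).submatrix id s).det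

/-- The Plücker ideal `I_{m,n} ⊆ ℤ[x]`: the algebraic relations among the `m × m` minors of the
generic `m × n` matrix. -/
def pluckerIdeal (m n : ℕ) : Ideal (MvPolynomial (Idx m n) ℤ) :=
  RingHom.ker (MvPolynomial.aeval (genericMinor m n) :
    MvPolynomial (Idx m n) ℤ →ₐ[ℤ] MvPolynomial (Fin m × Fin n) ℤ)

/-- The ideal generated by `I_{m,n}` in the polynomial ring over the Puiseux series. -/
def pluckerIdealPuiseux (k : Type*) [Field k] (m n : ℕ) :
    Ideal (MvPolynomial (Idx m n) (Puiseux k)) :=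
  (pluckerIdeal m n).map (MvPolynomial.map (Int.castRingHom (Puiseux k)))

/-- The tropical Grassmannian `G_{m,n}`, through tropical hypersurfaces. -/
def tropicalGrassmannian (k : Type*) [Field k] (m n : ℕ) : Set (Idx m n → ℝ) :=
  tropicalVariety (pluckerIdealPuiseux k m n)

/-- The tropical Grassmannian `G_{m,n}`, as a closure of a set of valuations. -/
def tropicalGrassmannianClosure (k : Type*) [Field k] (m n : ℕ) : Set (Idx m n → ℝ) :=
  tropicalVarietyClosure (pluckerIdealPuiseux k m n)

/-! ### The map `φ^(m)` -/

/-- The pair `i < j` as an index. -/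
def pairIdx {n : ℕ} (i j : Fin n) (h : i < j) : Idx 2 n :=
  OrderEmbedding.ofStrictMono ![i, j] (by
    intro a b hab
    fin_cases a <;> fin_cases b <;> simp_all)

/-- The symmetric matrix with zero diagonal whose entries above the diagonal are the
coordinates of `X ∈ ℝ ^ (n choose 2)`. -/
def dissim {n : ℕ} (X : Idx 2 n → ℝ) (i j : Fin n) : ℝ :=
  if h : i < j then X (pairIdx i j h) else if h : j < i then X (pairIdx j i h) else 0

/-- The map `φ^(m) : ℝ ^ (n choose 2) → ℝ ^ (n choose m)` for `m ≥ 2`: half of the minimum over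
the `m`-cycles `σ` of `∑ r < m, X (i_{σ^r(1)}, i_{σ^(r+1)(1)})`. -/
def phi (m : ℕ) [NeZero m] {n : ℕ} (X : Idx 2 n → ℝ) : Idx m n → ℝ := fun s =>
  1 / 2 * ⨅ σ : {σ : Equiv.Perm (Fin m) // σ.cycleType = {m}},
    ∑ r ∈ Finset.range m, dissim X (s ((σ.1 ^ r) 0)) (s ((σ.1 ^ (r + 1)) 0))

theorem dissim_comm {n : ℕ} (X : Idx 2 n → ℝ) (i j : Fin n) : dissim X i j = dissim X j i := by
  unfold dissim
  rcases lt_trichotomy i j with h | h | h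
  · simp [h, h.not_gt]
  · simp [h]
  · simp [h, h.not_gt]

/-- For `m = 3` the minimum is over two cycles with the same value. -/
theorem phi_three {n : ℕ} (X : Idx 2 n → ℝ) (s : Idx 3 n) :
    phi 3 X s =
      1 / 2 * (dissim X (s 0) (s 1) + dissim X (s 0) (s 2) + dissim X (s 1) (s 2)) := by
  have key : ∀ σ : Equiv.Perm (Fin 3), σ.cycleType = {3} →
      (σ 0 = 1 ∧ σ 1 = 2 ∧ σ 2 = 0) ∨ (σ 0 = 2 ∧ σ 2 = 1 ∧ σ 1 = 0) := by decide
  have hne : Nonempty {σ : Equiv.Perm (Fin 3) // σ.cycleType = {3}} :=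
    ⟨⟨finRotate 3, by decide⟩⟩
  unfold phi
  congr 1
  rw [← ciInf_const (ι := {σ : Equiv.Perm (Fin 3) // σ.cycleType = {3}})
    (a := dissim X (s 0) (s 1) + dissim X (s 0) (s 2) + dissim X (s 1) (s 2))]
  congr 1
  funext σ
  have hc1 := dissim_comm X (s 2) (s 0)
  have hc2 := dissim_comm X (s 1) (s 0)
  have hc3 := dissim_comm X (s 2) (s 1)
  rcases key σ.1 σ.2 with ⟨h0, h1, h2⟩ | ⟨h0, h1, h2⟩ <;>
    simp only [Finset.sum_range_succ, Finset.sum_range_zero, pow_succ, pow_zero, one_mul,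
      Equiv.Perm.mul_apply, Equiv.Perm.one_apply, h0, h1, h2] <;> linarith

end TropicalDissimilarity

end

open scoped BigOperators

noncomputable section

namespace TropicalDissimilarity

/-! ### Valuations of sums -/

section Valuation

variable {k : Type*} [Field k]

/-! The Veronese map sends a column `(a, b)` of a `2 × n` matrix to the column `(a ^ 2, a b, b ^
2)`, and by the homogeneous Vandermonde identity the minor on columns `i < j < k` of the new matrix
is the product of the three `2 × 2` minors of the old one. Hence the substitution `x_{ijk} ↦ x_{ij}
x_{ik} x_{jk}` carries `I_{3,n}` into `I_{2,n}` (`veroneseHom_mem_pluckerIdeal`). Tropically it is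
the linear map `X ↦ 2 φ^(3)(X)`. The factor `2` is absorbed by `t ↦ t ^ c`, which multiplies
valuations by `c` and fixes integers, so it preserves ideals generated over `ℤ`. For hypersurfaces,
a unique maximal term of `f` survives the substitution even if monomials merge
(`notMem_tropicalHypersurface_bind₁`); so if `φ^(3)(X)` failed for some `f`, then `X` would fail for
the image of the rescaled `f`. For closures, zeros are rescaled and multiplied explicitly, and
continuity of `φ^(3)` does the rest. -/

theorem min_val_le_val_add {a b : Puiseux k} (h : a + b ≠ 0) :
    min (val a) (val b) ≤ val (a + b) := by
  have h' : (a : HahnSeries ℚ k) + b ≠ 0 := by exact_mod_cast h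
  unfold val
  exact_mod_cast HahnSeries.min_order_le_order_add h'

theorem val_neg (a : Puiseux k) : val (-a) = val a := by
  simp [val, HahnSeries.order_neg]

theorem val_mul {a b : Puiseux k} (ha : a ≠ 0) (hb : b ≠ 0) : val (a * b) = val a + val b := by
  have ha' : (a : HahnSeries ℚ k) ≠ 0 := by exact_mod_cast ha
  have hb' : (b : HahnSeries ℚ k) ≠ 0 := by exact_mod_cast hb
  simp [val, HahnSeries.order_mul ha' hb']

theorem lt_val_sum {β : Type*} (S : Finset β) (g : β → Puiseux k) (r : ℝ)
    (h : ∀ b ∈ S, g b ≠ 0 → r < val (g b)) (hne : ∑ b ∈ S, g b ≠ 0) : r < val (∑ b ∈ S, g b) := by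
  classical
  induction S using Finset.induction_on with
  | empty => simp at hne
  | insert b S hb ih =>
    rw [Finset.sum_insert hb] at hne ⊢
    by_cases h0 : g b = 0
    · rw [h0, zero_add] at hne ⊢
      exact ih (fun c hc => h c (Finset.mem_insert_of_mem hc)) hne
    by_cases h1 : ∑ c ∈ S, g c = 0
    · rw [h1, add_zero]
      exact h b (Finset.mem_insert_self _ _) h0
    · exact (lt_min (h b (Finset.mem_insert_self _ _) h0)
        (ih (fun c hc => h c (Finset.mem_insert_of_mem hc)) h1)).trans_le (min_val_le_val_add hne)

/-- The strict ultrametric case: a larger valuation of the sum would contradict `a = (a + b) - b`.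
The guard `b ≠ 0` is needed because `val 0` is the default value `0`, not `∞`. -/
theorem val_add_of_lt {a b : Puiseux k} (ha : a ≠ 0) (h : b ≠ 0 → val a < val b) :
    a + b ≠ 0 ∧ val (a + b) = val a := by
  by_cases hb : b = 0
  · simp [hb, ha]
  have hlt := h hb
  have hab : a + b ≠ 0 := by
    intro h0
    rw [← neg_eq_of_add_eq_zero_right h0, val_neg] at hlt
    exact lt_irrefl _ hlt
  refine ⟨hab, le_antisymm ?_ ((min_eq_left hlt.le).symm.trans_le (min_val_le_val_add hab))⟩
  have h1 : (a + b) + -b ≠ 0 := by simpa using ha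
  have h2 := min_val_le_val_add h1
  rw [val_neg, add_neg_cancel_right] at h2
  exact (min_le_iff.1 h2).resolve_right hlt.not_ge

end Valuation

/-! ### Rescaling the exponents -/

section Scale

variable {k : Type*} [Field k]

/-- The ring homomorphism `t ↦ t ^ c` of Hahn series with rational exponents. -/
def scaleHahn (c : ℚ) (hc : 0 < c) : HahnSeries ℚ k →+* HahnSeries ℚ k :=
  HahnSeries.embDomainRingHom (AddMonoidHom.mulLeft c)
    (fun _ _ h => mul_left_cancel₀ hc.ne' h) (fun _ _ => mul_le_mul_iff_right₀ hc)

theorem order_scaleHahn (c : ℚ) (hc : 0 < c) {a : HahnSeries ℚ k} (ha : a ≠ 0) :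
    (scaleHahn c hc a).order = c * a.order := by
  have hne : scaleHahn c hc a ≠ 0 := (map_ne_zero _).2 ha
  have h : (scaleHahn c hc a).orderTop = _ := HahnSeries.orderTop_embDomain
  rw [← HahnSeries.order_eq_orderTop_of_ne_zero hne,
    ← HahnSeries.order_eq_orderTop_of_ne_zero ha] at h
  exact WithTop.coe_injective h

/-- The ring homomorphism `t ↦ t ^ c` of the field of Puiseux series. -/
def scale (c : ℚ) (hc : 0 < c) : Puiseux k →+* Puiseux k :=
  ((scaleHahn c hc).comp (puiseuxSubfield k).subtype).codRestrict (puiseuxSubfield k) (by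
    rintro ⟨a, N, hN, ha⟩
    refine ⟨N * c.den, Nat.mul_pos hN c.pos, fun q hq => ?_⟩
    obtain ⟨p, hp, rfl⟩ := HahnSeries.support_embDomain_subset hq
    obtain ⟨z, rfl⟩ := ha p hp
    -- If `q = c * (z / N)` and `c = num / den`, then `q = num * z / (N * den)`.
    refine ⟨c.num * z, ?_⟩
    have hN' : (N : ℚ) ≠ 0 := by exact_mod_cast hN.ne'
    have hd : (c.den : ℚ) ≠ 0 := by exact_mod_cast c.pos.ne'
    change c * ((z : ℚ) / N) = _
    push_cast
    nth_rewrite 1 [← Rat.num_div_den c]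
    field_simp)

theorem val_scale (c : ℚ) (hc : 0 < c) {a : Puiseux k} (ha : a ≠ 0) :
    val (scale c hc a) = c * val a := by
  have ha' : (a : HahnSeries ℚ k) ≠ 0 := by exact_mod_cast ha
  have h : ((scale c hc a : Puiseux k) : HahnSeries ℚ k) = scaleHahn c hc a := rfl
  rw [val, h, order_scaleHahn c hc ha', val]
  push_cast
  rfl

theorem scale_injective (c : ℚ) (hc : 0 < c) : Function.Injective (scale (k := k) c hc) :=
  (injective_iff_map_eq_zero _).2 fun _ => (map_eq_zero _).1

end Scale

/-! ### Tropical hypersurfaces under rescaling and under monomial substitutions -/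

section Hypersurface

variable {k : Type*} [Field k] {ι κ : Type*}

theorem exists_lt_of_notMem_tropicalHypersurface [Fintype ι] {f : MvPolynomial ι (Puiseux k)} (hf : f ≠ 0)
    {x : ι → ℝ} (hx : x ∉ tropicalHypersurface f) :
    ∃ a ∈ f.support, ∀ b ∈ f.support, b ≠ a → tropTerm f b x < tropTerm f a x := by
  obtain ⟨a, ha, hmax⟩ := f.support.exists_max_image (fun c => tropTerm f c x)
    (MvPolynomial.support_nonempty.2 hf)
  refine ⟨a, ha, fun b hb hba => lt_of_not_ge fun hle => hx ?_⟩
  exact ⟨a, ha, b, hb, hba.symm, hmax, fun c hc => (hmax c hc).trans hle⟩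

theorem notMem_tropicalHypersurface [Fintype ι] {f : MvPolynomial ι (Puiseux k)} {x : ι → ℝ} {a : ι →₀ ℕ}
    (ha : a ∈ f.support) (h : ∀ b ∈ f.support, b ≠ a → tropTerm f b x < tropTerm f a x) :
    x ∉ tropicalHypersurface f := by
  rintro ⟨b, hb, c, hc, hbc, hbmax, hcmax⟩
  by_cases hba : b = a
  · exact (h c hc (fun hca => hbc (hba.trans hca.symm))).not_ge (hcmax a ha)
  · exact (h b hb hba).not_ge (hbmax a ha)

theorem tropTerm_map_scale [Fintype ι] (c : ℚ) (hc : 0 < c) {f : MvPolynomial ι (Puiseux k)} {a : ι →₀ ℕ}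
    (ha : a ∈ f.support) (x : ι → ℝ) :
    tropTerm (f.map (scale c hc)) a ((c : ℝ) • x) = c * tropTerm f a x := by
  rw [tropTerm, tropTerm, MvPolynomial.coeff_map,
    val_scale c hc (MvPolynomial.mem_support_iff.1 ha), mul_add, Finset.mul_sum, mul_neg]
  congr 1
  refine Finset.sum_congr rfl fun i _ => ?_
  simp only [Pi.smul_apply, smul_eq_mul]
  ring

/-- The support is unchanged and every tropical term is multiplied by the same `c > 0`, so the
unique maximizer persists. -/
theorem smul_notMem_tropicalHypersurface_map_scale [Fintype ι] (c : ℚ) (hc : 0 < c)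
    {f : MvPolynomial ι (Puiseux k)} (hf : f ≠ 0) {x : ι → ℝ} (hx : x ∉ tropicalHypersurface f) :
    (c : ℝ) • x ∉ tropicalHypersurface (f.map (scale c hc)) := by
  obtain ⟨a, ha, hlt⟩ := exists_lt_of_notMem_tropicalHypersurface hf hx
  have hs : (f.map (scale c hc)).support = f.support :=
    MvPolynomial.support_map_of_injective f (scale_injective c hc)
  refine notMem_tropicalHypersurface (a := a) (hs ▸ ha) fun b hb hba => ?_
  rw [hs] at hb
  rw [tropTerm_map_scale c hc ha, tropTerm_map_scale c hc hb]
  exact mul_lt_mul_of_pos_left (hlt b hb hba) (by exact_mod_cast hc)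

theorem bind₁_monomial_one {R : Type*} [CommRing R] (e : κ → ι →₀ ℕ) (a : κ →₀ ℕ) (r : R) :
    MvPolynomial.bind₁ (fun s => MvPolynomial.monomial (e s) (1 : R))
      (MvPolynomial.monomial a r) = MvPolynomial.monomial (a.linearCombination ℕ e) r := by
  rw [MvPolynomial.bind₁_monomial, Finsupp.linearCombination_apply,
    MvPolynomial.monomial_finsupp_sum_index]
  simp [MvPolynomial.monomial_pow, Finsupp.prod]

/-- Distinct monomials may be sent to the same one, so a coefficient of the image is a sum over a
fibre and may cancel. -/
theorem coeff_bind₁_monomial {R : Type*} [CommRing R] [DecidableEq ι] (e : κ → ι →₀ ℕ)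
    (f : MvPolynomial κ R) (d : ι →₀ ℕ) :
    (MvPolynomial.bind₁ (fun s => MvPolynomial.monomial (e s) (1 : R)) f).coeff d =
      ∑ a ∈ f.support with a.linearCombination ℕ e = d, f.coeff a := by
  conv_lhs => rw [f.as_sum, map_sum, MvPolynomial.coeff_sum]
  simp only [bind₁_monomial_one, MvPolynomial.coeff_monomial, Finset.sum_filter]

theorem sum_linearCombination_mul [Fintype ι] [Fintype κ] (e : κ → ι →₀ ℕ) (a : κ →₀ ℕ) (x : ι → ℝ) :
    ∑ i, ((a.linearCombination ℕ e) i : ℝ) * x i = ∑ s, (a s : ℝ) * ∑ i, (e s i : ℝ) * x i := by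
  rw [Finsupp.linearCombination_apply, Finsupp.sum_fintype _ _ (by simp)]
  simp only [Finsupp.coe_finsetSum, Finset.sum_apply, Finsupp.smul_apply, smul_eq_mul,
    Nat.cast_sum, Nat.cast_mul, Finset.sum_mul, Finset.mul_sum]
  rw [Finset.sum_comm]
  simp only [mul_assoc]

/-- Exponents in one fibre of the substitution have the same linear part at `x`, so comparing their
terms means comparing valuations of coefficients. The coefficient of the unique maximal term
therefore strictly dominates its fibre and cannot be cancelled, while every other fibre yields a
strictly smaller term. -/
theorem notMem_tropicalHypersurface_bind₁ [Fintype ι] [Fintype κ] (e : κ → ι →₀ ℕ)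
    {f : MvPolynomial κ (Puiseux k)} (hf : f ≠ 0) {x : ι → ℝ} (hx : (fun s => ∑ i, (e s i : ℝ) * x i) ∉ tropicalHypersurface f) :
    MvPolynomial.bind₁ (fun s => MvPolynomial.monomial (e s) (1 : Puiseux k)) f ≠ 0 ∧
      x ∉ tropicalHypersurface
        (MvPolynomial.bind₁ (fun s => MvPolynomial.monomial (e s) (1 : Puiseux k)) f) := by
  classical
  obtain ⟨a, ha, hlt⟩ := exists_lt_of_notMem_tropicalHypersurface hf hx
  set F := MvPolynomial.bind₁ (fun s => MvPolynomial.monomial (e s) (1 : Puiseux k)) f with hF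
  set M := tropTerm f a (fun s => ∑ i, (e s i : ℝ) * x i) with hM
  set E : (κ →₀ ℕ) → (ι →₀ ℕ) := fun b => b.linearCombination ℕ e
  have hlin (b : κ →₀ ℕ) : tropTerm f b (fun s => ∑ i, (e s i : ℝ) * x i) =
      -val (f.coeff b) + ∑ i, (E b i : ℝ) * x i := by
    rw [tropTerm, sum_linearCombination_mul]
  have key (S : Finset (κ →₀ ℕ)) (d : ι →₀ ℕ) (hS : ∀ b ∈ S, b ∈ f.support ∧ b ≠ a ∧ E b = d)
      (hne : ∑ b ∈ S, f.coeff b ≠ 0) :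
      -- Used twice: for the rest of the fibre of `a`, and for each whole fibre that misses `a`.
      -val (∑ b ∈ S, f.coeff b) + ∑ i, (d i : ℝ) * x i < M := by
    have := lt_val_sum S (fun b => f.coeff b) (∑ i, (d i : ℝ) * x i - M) (fun b hb _ => by
      obtain ⟨h1, h2, rfl⟩ := hS b hb
      have := hlt b h1 h2
      rw [hlin b] at this
      linarith) hne
    linarith
  have hcoeff : F.coeff (E a) =
      f.coeff a + ∑ b ∈ (f.support.filter (fun b => E b = E a)).erase a, f.coeff b := by
    rw [hF, coeff_bind₁_monomial]
    exact (Finset.add_sum_erase (f.support.filter (fun b => E b = E a)) (fun b => f.coeff b) (Finset.mem_filter.2 ⟨ha, rfl⟩)).symm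
  obtain ⟨hne, hval⟩ := val_add_of_lt (MvPolynomial.mem_support_iff.1 ha)
    (b := ∑ b ∈ (f.support.filter (fun b => E b = E a)).erase a, f.coeff b) (fun hne => by
      have := key _ (E a) (fun b hb => by
        rw [Finset.mem_erase, Finset.mem_filter] at hb
        exact ⟨hb.2.1, hb.1, hb.2.2⟩) hne
      rw [hM, hlin a] at this
      linarith)
  rw [← hcoeff] at hne hval
  have hEa : tropTerm F (E a) x = M := by rw [hM, hlin a, tropTerm, hval]
  refine ⟨fun h0 => hne (by rw [h0, MvPolynomial.coeff_zero]),
    notMem_tropicalHypersurface (MvPolynomial.mem_support_iff.2 hne) fun d hd hda => ?_⟩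
  rw [MvPolynomial.mem_support_iff, hF, coeff_bind₁_monomial] at hd
  rw [hEa, tropTerm, hF, coeff_bind₁_monomial]
  refine key _ d (fun b hb => ?_) hd
  rw [Finset.mem_filter] at hb
  refine ⟨hb.1, ?_, hb.2⟩
  rintro rfl
  exact hda hb.2.symm

end Hypersurface

/-! ### The Veronese substitution -/

section Veronese

variable (k : Type*) [Field k] {n : ℕ}

/-- The exponent of the monomial `x_{i j} x_{i k} x_{j k}`. -/
def veroneseExp (s : Idx 3 n) : Idx 2 n →₀ ℕ :=
  Finsupp.single (pairIdx (s 0) (s 1) (s.strictMono (by decide))) 1 +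
    Finsupp.single (pairIdx (s 0) (s 2) (s.strictMono (by decide))) 1 +
    Finsupp.single (pairIdx (s 1) (s 2) (s.strictMono (by decide))) 1

/-- The substitution `x_{i j k} ↦ x_{i j} x_{i k} x_{j k}`. -/
def veroneseHom (R : Type*) [CommRing R] (n : ℕ) :
    MvPolynomial (Idx 3 n) R →ₐ[R] MvPolynomial (Idx 2 n) R :=
  MvPolynomial.bind₁ fun s => MvPolynomial.monomial (veroneseExp s) 1

@[simp]
theorem pairIdx_zero (i j : Fin n) (h : i < j) : pairIdx i j h 0 = i := rfl

@[simp]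
theorem pairIdx_one (i j : Fin n) (h : i < j) : pairIdx i j h 1 = j := rfl

theorem monomial_veroneseExp (R : Type*) [CommRing R] (s : Idx 3 n) :
    (MvPolynomial.monomial (veroneseExp s) 1 : MvPolynomial (Idx 2 n) R) =
      MvPolynomial.X (pairIdx (s 0) (s 1) (s.strictMono (by decide))) *
        MvPolynomial.X (pairIdx (s 0) (s 2) (s.strictMono (by decide))) *
        MvPolynomial.X (pairIdx (s 1) (s 2) (s.strictMono (by decide))) := by
  simp [veroneseExp, MvPolynomial.X, MvPolynomial.monomial_mul]

theorem sum_veroneseExp_mul (X : Idx 2 n → ℝ) (s : Idx 3 n) :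
    ∑ i, (veroneseExp s i : ℝ) * X i = 2 * phi 3 X s := by
  classical
  have h01 : s 0 < s 1 := s.strictMono (by decide)
  have h02 : s 0 < s 2 := s.strictMono (by decide)
  have h12 : s 1 < s 2 := s.strictMono (by decide)
  rw [phi_three]
  simp [veroneseExp, dissim, h01, h02, h12, add_mul, Finset.sum_add_distrib,
    Finsupp.single_apply]

/-- The generic point of the cone over the image of the Veronese curve: the `3 × n` matrix with
columns `(a ^ 2, a b, b ^ 2)`. -/
def veroneseMatrix (n : ℕ) (p : Fin 3 × Fin n) : MvPolynomial (Fin 2 × Fin n) ℤ :=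
  MvPolynomial.X (0, p.2) ^ (2 - (p.1 : ℕ)) * MvPolynomial.X (1, p.2) ^ (p.1 : ℕ)

/-- Homogeneous Vandermonde determinant; with increasing indices no sign appears. -/
theorem aeval_veroneseMatrix_genericMinor (s : Idx 3 n) :
    MvPolynomial.aeval (veroneseMatrix n) (genericMinor 3 n s) =
      MvPolynomial.aeval (genericMinor 2 n) (MvPolynomial.monomial (veroneseExp s) (1 : ℤ)) := by
  rw [monomial_veroneseExp]
  simp only [genericMinor, map_mul, MvPolynomial.aeval_X, Matrix.det_fin_three, Matrix.det_fin_two,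
    Matrix.submatrix_apply, Matrix.mvPolynomialX_apply, id, map_add, map_sub, veroneseMatrix,
    pairIdx_zero, pairIdx_one]
  simp
  ring

/-- Evaluating the image of `f` at the `2 × 2` minors amounts to specializing the relation `f = 0`
among `3 × 3` minors to the Veronese matrix. -/
theorem veroneseHom_mem_pluckerIdeal {f : MvPolynomial (Idx 3 n) ℤ} (hf : f ∈ pluckerIdeal 3 n) :
    veroneseHom ℤ n f ∈ pluckerIdeal 2 n := by
  have h : (MvPolynomial.aeval (genericMinor 2 n)).comp (veroneseHom ℤ n) =
      (MvPolynomial.aeval (veroneseMatrix n)).comp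
        (MvPolynomial.aeval (genericMinor 3 n) : _ →ₐ[ℤ] MvPolynomial (Fin 3 × Fin n) ℤ) := by
    ext1 s
    rw [AlgHom.comp_apply, AlgHom.comp_apply, veroneseHom, MvPolynomial.bind₁_X_right,
      MvPolynomial.aeval_X, aeval_veroneseMatrix_genericMinor]
  have hf' : MvPolynomial.aeval (genericMinor 3 n) f = 0 := hf
  have := DFunLike.congr_fun h f
  simp only [AlgHom.comp_apply, hf', map_zero] at this
  exact this

theorem map_pluckerIdealPuiseux_veroneseHom :
    (pluckerIdealPuiseux k 3 n).map (veroneseHom (Puiseux k) n) ≤ pluckerIdealPuiseux k 2 n := by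
  rw [Ideal.map_le_iff_le_comap, pluckerIdealPuiseux, Ideal.map_le_iff_le_comap]
  intro f hf
  have h := Ideal.mem_map_of_mem (MvPolynomial.map (Int.castRingHom (Puiseux k)))
    (veroneseHom_mem_pluckerIdeal hf)
  rw [veroneseHom, MvPolynomial.map_bind₁] at h
  simpa [veroneseHom, pluckerIdealPuiseux] using h

theorem map_scale_mem_pluckerIdealPuiseux (c : ℚ) (hc : 0 < c) {m : ℕ}
    {f : MvPolynomial (Idx m n) (Puiseux k)} (hf : f ∈ pluckerIdealPuiseux k m n) :
    f.map (scale c hc) ∈ pluckerIdealPuiseux k m n := by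
  suffices h : pluckerIdealPuiseux k m n ≤
      (pluckerIdealPuiseux k m n).comap (MvPolynomial.map (scale c hc)) from h hf
  conv_lhs => rw [pluckerIdealPuiseux]
  rw [Ideal.map_le_iff_le_comap]
  intro g hg
  rw [Ideal.mem_comap, Ideal.mem_comap, MvPolynomial.map_map, RingHom.ext_int
    ((scale c hc).comp (Int.castRingHom (Puiseux k))) (Int.castRingHom (Puiseux k))]
  exact Ideal.mem_map_of_mem _ hg

variable {k}

theorem mem_zeroLocus_pluckerIdealPuiseux {m : ℕ} {y : Idx m n → Puiseux k} :
    y ∈ MvPolynomial.zeroLocus (Puiseux k) (pluckerIdealPuiseux k m n) ↔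
      ∀ f ∈ pluckerIdeal m n, MvPolynomial.aeval y f = 0 := by
  have h : y ∈ MvPolynomial.zeroLocus (Puiseux k) (pluckerIdealPuiseux k m n) ↔
      pluckerIdealPuiseux k m n ≤ RingHom.ker (MvPolynomial.aeval (R := Puiseux k) y) := Iff.rfl
  rw [h, pluckerIdealPuiseux, Ideal.map_le_iff_le_comap]
  refine forall₂_congr fun f _ => ?_
  rw [Ideal.mem_comap, RingHom.mem_ker]
  simp [MvPolynomial.aeval_def, MvPolynomial.eval₂_map]

theorem scale_mem_zeroLocus (c : ℚ) (hc : 0 < c) {m : ℕ} {y : Idx m n → Puiseux k}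
    (hy : y ∈ MvPolynomial.zeroLocus (Puiseux k) (pluckerIdealPuiseux k m n)) :
    (fun i => scale c hc (y i)) ∈
      MvPolynomial.zeroLocus (Puiseux k) (pluckerIdealPuiseux k m n) := by
  rw [mem_zeroLocus_pluckerIdealPuiseux] at hy ⊢
  intro f hf
  have h := MvPolynomial.map_aeval y (scale c hc) f
  rw [hy f hf, map_zero] at h
  rw [h, MvPolynomial.coe_eval₂Hom, MvPolynomial.aeval_def]
  congr 1
  exact RingHom.ext_int _ _

theorem veronese_mem_zeroLocus {y : Idx 2 n → Puiseux k}
    (hy : y ∈ MvPolynomial.zeroLocus (Puiseux k) (pluckerIdealPuiseux k 2 n)) :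
    (fun s => MvPolynomial.aeval y (MvPolynomial.monomial (veroneseExp s) (1 : Puiseux k))) ∈
      MvPolynomial.zeroLocus (Puiseux k) (pluckerIdealPuiseux k 3 n) := by
  intro f hf
  have h := hy _ (map_pluckerIdealPuiseux_veroneseHom k (Ideal.mem_map_of_mem _ hf))
  rwa [veroneseHom, MvPolynomial.aeval_bind₁] at h

end Veronese

/-! ### Images of tropical Grassmannians -/

section Image

variable {k : Type*} [Field k] {n : ℕ}

theorem phi_three_mem_tropicalGrassmannian {X : Idx 2 n → ℝ}
    (hX : X ∈ tropicalGrassmannian k 2 n) : phi 3 X ∈ tropicalGrassmannian k 3 n := by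
  intro f hf hf0
  by_contra hx
  -- Scaling by `2` clears the `1 / 2` in `phi`, leaving the integral exponents of the substitution.
  have hscale := smul_notMem_tropicalHypersurface_map_scale 2 two_pos hf0 hx
  have hX2 : (((2 : ℚ) : ℝ) • phi 3 X : Idx 3 n → ℝ) =
      fun s => ∑ i, (veroneseExp s i : ℝ) * X i := by
    funext s
    simp [sum_veroneseExp_mul]
  rw [hX2] at hscale
  have hne : f.map (scale 2 two_pos) ≠ 0 := fun h0 =>
    hf0 (MvPolynomial.map_injective _ (scale_injective 2 two_pos) (by rw [h0, map_zero]))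
  obtain ⟨h1, h2⟩ := notMem_tropicalHypersurface_bind₁ veroneseExp hne hscale
  exact h2 (hX _ (map_pluckerIdealPuiseux_veroneseHom k (Ideal.mem_map_of_mem _
    (map_scale_mem_pluckerIdealPuiseux k 2 two_pos hf))) h1)

theorem continuous_phi_three : Continuous (phi 3 : (Idx 2 n → ℝ) → Idx 3 n → ℝ) := by
  refine continuous_pi fun s => ?_
  have h (X : Idx 2 n → ℝ) : phi 3 X s = 1 / 2 * ∑ i, (veroneseExp s i : ℝ) * X i := by
    rw [sum_veroneseExp_mul]
    ring
  simp only [h]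
  fun_prop

theorem phi_three_neg_val {y : Idx 2 n → Puiseux k} (hy : ∀ i, y i ≠ 0) (s : Idx 3 n) :
    phi 3 (fun i => -val (y i)) s = -val (MvPolynomial.aeval
      (fun i => scale (1 / 2) one_half_pos (y i))
      (MvPolynomial.monomial (veroneseExp s) (1 : Puiseux k))) := by
  have h01 : s 0 < s 1 := s.strictMono (by decide)
  have h02 : s 0 < s 2 := s.strictMono (by decide)
  have h12 : s 1 < s 2 := s.strictMono (by decide)
  have hs (i : Idx 2 n) : scale (1 / 2) one_half_pos (y i) ≠ 0 := (map_ne_zero _).2 (hy i)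
  rw [phi_three, monomial_veroneseExp]
  simp only [map_mul, MvPolynomial.aeval_X]
  rw [val_mul (mul_ne_zero (hs _) (hs _)) (hs _), val_mul (hs _) (hs _), val_scale _ _ (hy _),
    val_scale _ _ (hy _), val_scale _ _ (hy _)]
  simp only [dissim, h01, h02, h12, dif_pos]
  push_cast
  ring

theorem phi_three_mem_tropicalGrassmannianClosure {X : Idx 2 n → ℝ}
    (hX : X ∈ tropicalGrassmannianClosure k 2 n) :
    phi 3 X ∈ tropicalGrassmannianClosure k 3 n := by
  refine map_mem_closure continuous_phi_three hX ?_
  rintro _ ⟨y, hy, hy0, rfl⟩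
  refine ⟨_, veronese_mem_zeroLocus (scale_mem_zeroLocus (1 / 2) one_half_pos hy), fun s => ?_,
    funext (phi_three_neg_val hy0)⟩
  rw [monomial_veroneseExp]
  simp [hy0]

end Image

end TropicalDissimilarity

end

theorem mainTheorem3 (k : Type*) [Field k] [CharZero k] (n : ℕ) :
    TropicalDissimilarity.phi 3 '' TropicalDissimilarity.tropicalGrassmannian k 2 n ⊆
        TropicalDissimilarity.tropicalGrassmannian k 3 n ∧
      TropicalDissimilarity.phi 3 '' TropicalDissimilarity.tropicalGrassmannianClosure k 2 n ⊆
        TropicalDissimilarity.tropicalGrassmannianClosure k 3 n :=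
  ⟨Set.image_subset_iff.2 fun _ => TropicalDissimilarity.phi_three_mem_tropicalGrassmannian,
    Set.image_subset_iff.2 fun _ =>
      TropicalDissimilarity.phi_three_mem_tropicalGrassmannianClosure⟩
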